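/- All rings are commutative with identity, and $\mathrm{Id}(R)$ denotes the set of ideals of a ring $R$. A proper ideal $I$ of a ring $R$ is *$n$-absorbing* ($n$ a positive integer) if, whenever $r_1\cdots r_{n+1}\in I$ with $r_1,\dots,r_{n+1}\in R$, there are $n$ of the $r_i$'s whose product is in $I$. For an ideal $I$ of $R$ let $\omega_R(I)$ be the least positive integer $n$ such that $I$ is an $n$-absorbing ideal of $R$, and $\omega_R(I)=\infty$ if there is no such $n$ (in particular $\omega_R(R)=\infty$). Let $R$ be a ring and $B$ an $R$-algebra. A function $A\colon B\to\mathrm{Id}(R)$, $f\mapsto A_f$, is an *amount function* if for all $s\in R$ and $f,g\in B$: $A_0=(0)$ and $A_1=R$; if $A_f=(0)$ then $f=0$; $A_{sf}=sA_f$; and $A_{fg}\subseteq A_fA_g$. The algebra $B$, together with an amount function $A$ and a function $\epsilon\colon\mathrm{Id}(R)\to\mathrm{Id}(B)$, $I\mapsto I^{\epsilon}$, is an *amount $R$-algebra* if 1. for all $f,g\in B$ there are non-negative integers $m,n$ such that $A_f^mA_g^nA_{fg}=A_f^{m+1}A_g^{n+1}$; 2. for all $f\in B$ and all ideals $I$ of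 $R$, $A_f\subseteq I$ if and only if $f\in I^{\epsilon}$; 3. for all ideals $I$ of $R$, $I^{\epsilon}\cap R=I$, where $I^{\epsilon}\cap R$ denotes the preimage of $I^{\epsilon}$ under the structure map $R\to B$. An amount $R$-algebra $B$ is *Gaussian* if $A_{fg}=A_fA_g$ for all $f,g\in B$. A *Prüfer domain* is an integral domain in which every nonzero finitely generated ideal is invertible. **Corollary.** Let $D$ be a Prüfer domain and let $B$ be a Gaussian amount $D$-algebra, with amount function $A$ and ideal map $\epsilon$. Then $\omega_B(I^{\epsilon})=\omega_D(I)$ for every ideal $I$ of $D$. In particular, if $I$ is an ideal of a Dedekind domain $D$ (fields being allowed), then \[\omega_{D[[X]]}(I[[X]])=\omega_{D[X]}(I[X])=\omega_D(I),\] where $I[X]$ and $I[[X]]$ denote the ideals of all polynomials in $D[X]$, respectively all power series in $D[[X]]$, with all coefficients in $I$. -/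

import Mathlib

/-- A Prüfer domain: an integral domain in which every nonzero finitely generated ideal is
invertible (as a fractional ideal of the field of fractions). -/
structure IsPruferDomain (D : Type*) [CommRing D] : Prop where
  isDomain : IsDomain D
  invertible : ∀ I : Ideal D, I ≠ ⊥ → I.FG →
    IsUnit (I : FractionalIdeal (nonZeroDivisors D) (FractionRing D))

/-- An amount function from an `R`-algebra `B` to the set of ideals of `R`. -/
structure IsAmountFunction {R B : Type*} [CommRing R] [CommRing B] [Algebra R B]
    (A : B → Ideal R) : Prop where
  map_zero : A 0 = ⊥
  map_one : A 1 = ⊤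
  eq_zero : ∀ f : B, A f = ⊥ → f = 0
  homogeneous : ∀ (s : R) (f : B), A (s • f) = Ideal.span {s} * A f
  submultiplicative : ∀ f g : B, A (f * g) ≤ A f * A g

/-- `B` is an amount `R`-algebra, with amount function `A` and with the map `ε` from the ideals
of `R` to the ideals of `B`. -/
structure IsAmountAlgebra {R B : Type*} [CommRing R] [CommRing B] [Algebra R B]
    (A : B → Ideal R) (ε : Ideal R → Ideal B) : Prop where
  isAmountFunction : IsAmountFunction A
  amount_formula : ∀ f g : B, ∃ m n : ℕ,
    A f ^ m * A g ^ n * A (f * g) = A f ^ (m + 1) * A g ^ (n + 1)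
  le_iff_mem : ∀ (f : B) (I : Ideal R), A f ≤ I ↔ f ∈ ε I
  comap_eq : ∀ I : Ideal R, (ε I).comap (algebraMap R B) = I

/-- `B` is a Gaussian amount `R`-algebra, with amount function `A` and ideal map `ε`. -/
structure IsGaussianAmountAlgebra {R B : Type*} [CommRing R] [CommRing B] [Algebra R B]
    (A : B → Ideal R) (ε : Ideal R → Ideal B) : Prop extends IsAmountAlgebra A ε where
  gaussian : ∀ f g : B, A (f * g) = A f * A g

/-- A proper ideal `I` is `n`-absorbing if, whenever a product of `n + 1` elements of `R` lies
in `I`, some product of `n` of these elements (omitting the `i`-th one) already lies in `I`. -/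
def IsNAbsorbing {R : Type*} [CommRing R] (n : ℕ) (I : Ideal R) : Prop :=
  I ≠ ⊤ ∧ ∀ r : Fin (n + 1) → R, ∏ i, r i ∈ I →
    ∃ i : Fin (n + 1), ∏ j ∈ Finset.univ.erase i, r j ∈ I

/-- `ω_R(I)`: the least positive integer `n` such that `I` is `n`-absorbing, and `∞` if there is
none (in `ℕ∞` the infimum of the empty set is `∞`). -/
noncomputable def absorbingNumber {R : Type*} [CommRing R] (I : Ideal R) : ℕ∞ :=
  sInf {k : ℕ∞ | ∃ n : ℕ, 0 < n ∧ IsNAbsorbing n I ∧ k = (n : ℕ∞)}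

/-- `I[[X]]`: the ideal of `R[[X]]` of all power series with coefficients in `I`. -/
def powerSeriesIdeal {R : Type*} [CommRing R] (I : Ideal R) : Ideal (PowerSeries R) where
  carrier := {f | ∀ n : ℕ, PowerSeries.coeff n f ∈ I}
  zero_mem' := fun n => by simp
  add_mem' := fun {f g} hf hg n => by
    rw [map_add]
    exact I.add_mem (hf n) (hg n)
  smul_mem' := fun f g hg n => by
    rw [smul_eq_mul, PowerSeries.coeff_mul]
    exact I.sum_mem fun p _ => I.mul_mem_left _ (hg p.2)

/-! Since `A` is multiplicative, `∏ f i ∈ ε I` iff `∏ A (f i) ≤ I`, so `ε I` is `n`-absorbing once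
`I` is so for products of ideals; the converse is the case of constants. To pass from elements to
ideals (`IsNAbsorbing.exists_prod_ideal_le`), assume every `n`-fold subproduct fails. The failure
omitting `i` is witnessed by elements and by a maximal ideal `M i`. Finitely generated ideals are
locally principal, and one element of `J j` can generate the witnesses in `J j` at all the `M i`
together. Absorption of these single elements then contradicts some witness. For `D[X]` and `D[[X]]`
over a Dedekind domain, the content ideal is multiplicative, by the same localisation. -/

/-! ### Local generators in Prüfer domains. -/

/-- An invertible ideal divides a nonzero principal ideal. -/
theorem Ideal.exists_mul_eq_span_singleton_of_isUnit {D : Type*} [CommRing D] [IsDomain D]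
    {J : Ideal D} (hJ : IsUnit (J : FractionalIdeal (nonZeroDivisors D) (FractionRing D))) :
    ∃ (K : Ideal D) (d : D), d ≠ 0 ∧ J * K = Ideal.span {d} := by
  obtain ⟨L, hL⟩ := hJ.exists_right_inv
  obtain ⟨d, K, hd, rfl⟩ := FractionalIdeal.exists_eq_spanSingleton_mul L
  refine ⟨K, d, hd, ?_⟩
  have hd' : algebraMap D (FractionRing D) d ≠ 0 := by
    simpa using hd
  apply FractionalIdeal.coeIdeal_injective (K := FractionRing D)
  beta_reduce
  rw [FractionalIdeal.coeIdeal_mul, FractionalIdeal.coeIdeal_span_singleton]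
  rw [mul_left_comm] at hL
  rw [← mul_one (FractionalIdeal.spanSingleton _ _), ← hL, ← mul_assoc,
    FractionalIdeal.spanSingleton_mul_spanSingleton, mul_inv_cancel₀ hd',
    FractionalIdeal.spanSingleton_one, one_mul]

/-- In a Prüfer domain a finitely generated ideal `J` contains an element generating `J` locally
at each of finitely many given maximal ideals. -/
theorem IsPruferDomain.exists_local_generator {D : Type*} [CommRing D] (hD : IsPruferDomain D)
    {J : Ideal D} (hJ : J.FG) (S : Finset (Ideal D)) (hS : ∀ M ∈ S, M.IsMaximal) :
    ∃ a ∈ J, ∀ M ∈ S, ∃ s ∉ M, ∀ x ∈ J, ∃ t, s * x = a * t := by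
  classical
  have := hD.isDomain
  by_cases h0 : J = ⊥
  · subst h0
    refine ⟨0, by simp, fun M hM => ⟨1, (Ideal.ne_top_iff_one M).1 (hS M hM).ne_top, ?_⟩⟩
    intro x hx
    exact ⟨0, by simpa using hx⟩
  obtain ⟨K, d, hd, hJK⟩ :=
    Ideal.exists_mul_eq_span_singleton_of_isUnit (hD.invertible J h0 hJ)
  have hdvd : ∀ x ∈ J, ∀ k ∈ K, ∃ t, x * k = d * t := fun x hx k hk =>
    Ideal.mem_span_singleton.1 (hJK ▸ Ideal.mul_mem_mul hx hk)
  have hloc : ∀ M ∈ S, ∃ x ∈ J, ∃ k ∈ K, ∃ t ∉ M, x * k = d * t := by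
    intro M hM
    by_contra! h
    -- If every quotient `x * k / d` lay in `M`, then `d ∈ d M`, and cancelling `d` would give `1 ∈
    -- M`.
    have hle : J * K ≤ Ideal.span {d} * M := Ideal.mul_le.2 fun x hx k hk => by
      obtain ⟨t, ht⟩ := hdvd x hx k hk
      have htM : t ∈ M := by
        by_contra hn
        exact h x hx k hk t hn ht
      exact Ideal.mem_span_singleton_mul.2 ⟨t, htM, ht.symm⟩
    have hdm : d ∈ Ideal.span {d} * M := hle (hJK ▸ Ideal.mem_span_singleton_self d)
    obtain ⟨z, hz, hdz⟩ := Ideal.mem_span_singleton_mul.1 hdm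
    have : z = 1 := mul_left_cancel₀ hd (by rw [hdz, mul_one])
    exact (Ideal.ne_top_iff_one M).1 (hS M hM).ne_top (this ▸ hz)
  have hsep : ∀ M ∈ S, ∃ e ∉ M, ∀ N ∈ S, N ≠ M → e ∈ N := by
    intro M hM
    have hMm := hS M hM
    have hnle : ¬ (S.erase M).inf id ≤ M := by
      rw [hMm.isPrime.inf_le']
      rintro ⟨N, hN, hle⟩
      rw [Finset.mem_erase] at hN
      exact hN.1 ((hS N hN.2).eq_of_le hMm.ne_top hle)
    obtain ⟨e, he, heM⟩ := SetLike.not_le_iff_exists.1 hnle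
    refine ⟨e, heM, fun N hN hne => ?_⟩
    exact (Finset.inf_le (f := id) (Finset.mem_erase.2 ⟨hne, hN⟩) : _ ≤ N) he
  choose! x hxJ k hkK u huM hxk using hloc
  choose! e heM heN using hsep
  -- The local generators `x N` are glued with weights `e N`: modulo `M ∈ S` only the weight `e M`
  -- survives.
  refine ⟨∑ N ∈ S, e N * x N, J.sum_mem fun N hN => J.mul_mem_left _ (hxJ N hN), fun M hM => ?_⟩
  have hMm := hS M hM
  have hcoef : ∀ N ∈ S, ∃ t, x N * k M = d * t := fun N hN => hdvd _ (hxJ N hN) _ (hkK M hM)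
  choose! w hw using hcoef
  have hak : (∑ N ∈ S, e N * x N) * k M = d * ∑ N ∈ S, e N * w N := by
    rw [Finset.sum_mul, Finset.mul_sum]
    refine Finset.sum_congr rfl fun N hN => ?_
    rw [mul_assoc, hw N hN]
    ring
  -- The multiplier `s` is `a * k M / d`, congruent to `e M * u M` modulo `M`.
  refine ⟨∑ N ∈ S, e N * w N, fun hmem => ?_, fun y hy => ?_⟩
  · rw [← Finset.add_sum_erase S _ hM] at hmem
    have hrest : ∑ N ∈ S.erase M, e N * w N ∈ M := M.sum_mem fun N hN => by
      rw [Finset.mem_erase] at hN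
      exact M.mul_mem_right _ (heN N hN.2 M hM hN.1.symm)
    have hwu : w M = u M := mul_left_cancel₀ hd ((hw M hM).symm.trans (hxk M hM))
    rcases hMm.isPrime.mem_or_mem ((M.add_mem_iff_left hrest).1 hmem) with h | h
    · exact heM M hM h
    · exact huM M hM (hwu ▸ h)
  · obtain ⟨t, ht⟩ := hdvd y hy _ (hkK M hM)
    refine ⟨t, mul_left_cancel₀ hd ?_⟩
    rw [← mul_assoc, ← hak]
    linear_combination (∑ N ∈ S, e N * x N) * ht

/-! ### Absorption for products of ideals. -/

/-- If `x ∉ I`, some maximal ideal contains every `s` with `s * x ∈ I`. -/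
theorem Ideal.exists_isMaximal_of_notMem {R : Type*} [CommRing R] {I : Ideal R} {x : R}
    (hx : x ∉ I) : ∃ M : Ideal R, M.IsMaximal ∧ ∀ s, s * x ∈ I → s ∈ M := by
  have hne : Submodule.colon I {x} ≠ ⊤ := fun h => hx <| by
    have h1 : (1 : R) ∈ Submodule.colon I {x} := h ▸ Submodule.mem_top
    simpa using Submodule.mem_colon_singleton.1 h1
  obtain ⟨M, hM, hle⟩ := Ideal.exists_le_maximal _ hne
  exact ⟨M, hM, fun s hs => hle (Submodule.mem_colon_singleton.2 hs)⟩

open scoped Pointwise in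
/-- A product of ideals is contained in `I` as soon as all products of elements are. -/
theorem Ideal.prod_le_of_forall_prod_mem {R ι : Type*} [CommRing R] {s : Finset ι}
    {J : ι → Ideal R} {I : Ideal R}
    (h : ∀ y : ι → R, (∀ j, y j ∈ J j) → ∏ j ∈ s, y j ∈ I) : ∏ j ∈ s, J j ≤ I := by
  classical
  have hspan : ∏ j ∈ s, J j = Ideal.span (∏ j ∈ s, (J j : Set R)) := by
    rw [← Ideal.prod_span]
    simp
  rw [hspan, Ideal.span_le]
  intro z hz
  obtain ⟨g, hg, rfl⟩ := (Set.mem_finsetProd _ _ _).1 hz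
  -- `g` is controlled only on `s`; the value `0` lies in every `J j` elsewhere.
  have := h (fun j => if j ∈ s then g j else 0) fun j => by
    by_cases hj : j ∈ s
    · simpa [hj] using hg hj
    · simp [hj]
  rwa [Finset.prod_congr rfl fun j hj => if_pos hj] at this

/-- In a Prüfer domain, `n`-absorbing ideals are strongly `n`-absorbing: the defining condition
holds for products of ideals. -/
theorem IsNAbsorbing.exists_prod_ideal_le {D : Type*} [CommRing D] (hD : IsPruferDomain D)
    {n : ℕ} {I : Ideal D} (hI : IsNAbsorbing n I) (J : Fin (n + 1) → Ideal D)
    (hJ : ∏ i, J i ≤ I) : ∃ i, ∏ j ∈ Finset.univ.erase i, J j ≤ I := by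
  classical
  by_contra! hcon
  have hy : ∀ i, ∃ y : Fin (n + 1) → D, (∀ j, y j ∈ J j) ∧
      ∏ j ∈ Finset.univ.erase i, y j ∉ I := by
    intro i
    by_contra! h
    exact hcon i (Ideal.prod_le_of_forall_prod_mem h)
  choose y hyJ hyI using hy
  choose M hM hMI using fun i => Ideal.exists_isMaximal_of_notMem (hyI i)
  -- `J j` need not be finitely generated, so it is replaced by the span of its finitely many
  -- witnesses.
  have hgen := fun j => hD.exists_local_generator
    (J := Ideal.span (Set.range fun i => y i j)) ⟨Finset.univ.image fun i => y i j, by simp⟩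
    (Finset.univ.image M) (by simpa using hM)
  choose a ha hloc using hgen
  have haJ : ∀ j, a j ∈ J j := fun j =>
    (Ideal.span_le.2 (by rintro _ ⟨i, rfl⟩; exact hyJ i j) : _ ≤ J j) (ha j)
  obtain ⟨i, hi⟩ := hI.2 a (hJ (Ideal.prod_mem_prod fun j _ => haJ j))
  have hmul : ∀ j, ∃ s ∉ M i, ∃ t, s * y i j = a j * t := fun j => by
    obtain ⟨s, hs, h⟩ := hloc j (M i) (Finset.mem_image_of_mem _ (Finset.mem_univ i))
    exact ⟨s, hs, h _ (Ideal.subset_span ⟨i, rfl⟩)⟩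
  choose s hs t ht using hmul
  have hmem : ∏ j ∈ Finset.univ.erase i, s j ∈ M i := by
    apply hMI i
    rw [← Finset.prod_mul_distrib, Finset.prod_congr rfl fun j _ => ht j,
      Finset.prod_mul_distrib]
    exact I.mul_mem_right _ hi
  obtain ⟨j, _, hj⟩ := ((hM i).isPrime.prod_mem_iff).1 hmem
  exact hs j hj

/-! ### Transfer to Gaussian amount algebras. -/

theorem IsGaussianAmountAlgebra.map_prod {R B ι : Type*} [CommRing R] [CommRing B] [Algebra R B]
    {A : B → Ideal R} {ε : Ideal R → Ideal B} (h : IsGaussianAmountAlgebra A ε)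
    (s : Finset ι) (f : ι → B) : A (∏ i ∈ s, f i) = ∏ i ∈ s, A (f i) := by
  classical
  induction s using Finset.induction_on with
  | empty => simp [h.isAmountFunction.map_one]
  | insert i s hi ih => rw [Finset.prod_insert hi, Finset.prod_insert hi, h.gaussian, ih]

/-- In a Gaussian amount algebra over a Prüfer domain, `ε I` and `I` are `n`-absorbing for the
same `n`. -/
theorem IsGaussianAmountAlgebra.isNAbsorbing_iff {D B : Type*} [CommRing D] [CommRing B]
    [Algebra D B] {A : B → Ideal D} {ε : Ideal D → Ideal B} (h : IsGaussianAmountAlgebra A ε)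
    (hD : IsPruferDomain D) (n : ℕ) (I : Ideal D) : IsNAbsorbing n (ε I) ↔ IsNAbsorbing n I := by
  have hmem : ∀ r : D, algebraMap D B r ∈ ε I ↔ r ∈ I := fun r => by
    rw [← Ideal.mem_comap, h.comap_eq]
  have htop : ε I = ⊤ ↔ I = ⊤ := by
    rw [Ideal.eq_top_iff_one, Ideal.eq_top_iff_one, ← hmem, map_one]
  refine ⟨fun hε => ⟨fun hI => hε.1 (htop.2 hI), fun r hr => ?_⟩,
    fun hI => ⟨fun hε => hI.1 (htop.1 hε), fun f hf => ?_⟩⟩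
  · obtain ⟨i, hi⟩ := hε.2 (fun j => algebraMap D B (r j))
      (by rw [← _root_.map_prod]; exact (hmem _).2 hr)
    rw [← _root_.map_prod, hmem] at hi
    exact ⟨i, hi⟩
  · rw [← h.le_iff_mem, h.map_prod] at hf
    obtain ⟨i, hi⟩ := hI.exists_prod_ideal_le hD _ hf
    exact ⟨i, by rwa [← h.le_iff_mem, h.map_prod]⟩

theorem IsGaussianAmountAlgebra.absorbingNumber_eq {D B : Type*} [CommRing D] [CommRing B]
    [Algebra D B] {A : B → Ideal D} {ε : Ideal D → Ideal B} (h : IsGaussianAmountAlgebra A ε)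
    (hD : IsPruferDomain D) (I : Ideal D) : absorbingNumber (ε I) = absorbingNumber I := by
  simp only [absorbingNumber, h.isNAbsorbing_iff hD]

theorem IsDedekindDomain.isPruferDomain {D : Type*} [CommRing D] [IsDedekindDomain D] :
    IsPruferDomain D where
  isDomain := inferInstance
  invertible _ hI _ := isUnit_iff_ne_zero.2 (FractionalIdeal.coeIdeal_ne_zero.2 hI)

/-! ### Content ideals and Gauss's lemma. -/

/-- The content ideal of a power series, generated by its coefficients. -/
def PowerSeries.contentIdeal {R : Type*} [CommRing R] (f : PowerSeries R) : Ideal R :=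
  Ideal.span (Set.range fun n => PowerSeries.coeff n f)

namespace PowerSeries

theorem coeff_mem_contentIdeal {R : Type*} [CommRing R] (f : PowerSeries R) (n : ℕ) :
    coeff n f ∈ f.contentIdeal := Ideal.subset_span ⟨n, rfl⟩

theorem contentIdeal_le_iff {R : Type*} [CommRing R] {f : PowerSeries R} {I : Ideal R} :
    f.contentIdeal ≤ I ↔ ∀ n, coeff n f ∈ I := by
  rw [contentIdeal, Ideal.span_le, Set.range_subset_iff]
  rfl

theorem contentIdeal_smul {R : Type*} [CommRing R] (s : R) (f : PowerSeries R) :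
    (s • f).contentIdeal = Ideal.span {s} * f.contentIdeal := by
  rw [contentIdeal, contentIdeal, Ideal.span_mul_span', Set.singleton_mul, ← Set.range_comp]
  rfl

theorem contentIdeal_mul_le {R : Type*} [CommRing R] (f g : PowerSeries R) :
    (f * g).contentIdeal ≤ f.contentIdeal * g.contentIdeal :=
  contentIdeal_le_iff.2 fun n => by
    rw [coeff_mul]
    exact Ideal.sum_mem _ fun p _ =>
      Ideal.mul_mem_mul (coeff_mem_contentIdeal f _) (coeff_mem_contentIdeal g _)

theorem isAmountFunction_contentIdeal {R : Type*} [CommRing R] :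
    IsAmountFunction (contentIdeal : PowerSeries R → Ideal R) where
  map_zero := eq_bot_iff.2 (contentIdeal_le_iff.2 fun n => by simp)
  map_one := (Ideal.eq_top_iff_one _).2 (by
    have h := coeff_mem_contentIdeal (1 : PowerSeries R) 0
    rwa [coeff_zero_one] at h)
  eq_zero f hf := by
    ext n
    simpa using contentIdeal_le_iff.1 hf.le n
  homogeneous := contentIdeal_smul
  submultiplicative := contentIdeal_mul_le

/-- The product of two power series having coefficients outside a prime ideal has a coefficient
outside it. -/
theorem exists_coeff_mul_notMem {R : Type*} [CommRing R] {P : Ideal R} [P.IsPrime]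
    {f g : PowerSeries R} (hf : ¬ f.contentIdeal ≤ P) (hg : ¬ g.contentIdeal ≤ P) :
    ∃ n, coeff n (f * g) ∉ P := by
  have key : ∀ h : PowerSeries R, PowerSeries.map (Ideal.Quotient.mk P) h = 0 ↔
      h.contentIdeal ≤ P := fun h => by
    simp [contentIdeal_le_iff, PowerSeries.ext_iff, Ideal.Quotient.eq_zero_iff_mem]
  have hne : ¬ (f * g).contentIdeal ≤ P := by
    rw [← key, map_mul, mul_eq_zero, key, key]
    tauto
  simpa [contentIdeal_le_iff] using hne

/-- Locally at a maximal ideal `M` of a Noetherian Prüfer domain, a nonzero power series is a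
multiple of a power series with a coefficient outside `M`. -/
theorem exists_smul_eq_smul {D : Type*} [CommRing D] [IsNoetherianRing D]
    (hD : IsPruferDomain D) {f : PowerSeries D} (hf : f ≠ 0) {M : Ideal D} (hM : M.IsMaximal) :
    ∃ s ∉ M, ∃ (a : D) (f' : PowerSeries D), s • f = a • f' ∧ ¬ f'.contentIdeal ≤ M := by
  have := hD.isDomain
  obtain ⟨a, ha, hloc⟩ := hD.exists_local_generator (IsNoetherian.noetherian f.contentIdeal) {M}
    (by simpa using hM)
  obtain ⟨s, hs, h⟩ := hloc M (by simp)
  choose c hc using fun n => h _ (coeff_mem_contentIdeal f n)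
  have heq : s • f = a • PowerSeries.mk c := by
    ext n
    simpa using hc n
  refine ⟨s, hs, a, PowerSeries.mk c, heq, fun hle => hs ?_⟩
  have ha0 : a ≠ 0 := by
    rintro rfl
    have hs0 : s ≠ 0 := by
      rintro rfl
      exact hs M.zero_mem
    refine hf (PowerSeries.ext fun n => ?_)
    have := hc n
    rw [zero_mul] at this
    simpa [hs0] using this
  -- As `a` lies in the content of `f`, `s * a` lies in `a` times the content of `f'`; cancelling
  -- `a` puts `s` in that content.
  have hsa : s * a ∈ Ideal.span {a} * (PowerSeries.mk c).contentIdeal := by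
    rw [← contentIdeal_smul, ← heq, contentIdeal_smul]
    exact Ideal.mul_mem_mul (Ideal.mem_span_singleton_self s) ha
  obtain ⟨z, hz, hza⟩ := Ideal.mem_span_singleton_mul.1 hsa
  have : z = s := mul_left_cancel₀ ha0 (by rw [hza, mul_comm])
  exact hle (this ▸ hz)

/-- Gauss's lemma for power series over a Noetherian Prüfer domain. -/
theorem contentIdeal_mul {D : Type*} [CommRing D] [IsNoetherianRing D]
    (hD : IsPruferDomain D) (f g : PowerSeries D) :
    (f * g).contentIdeal = f.contentIdeal * g.contentIdeal := by
  have h0 : (0 : PowerSeries D).contentIdeal = ⊥ := isAmountFunction_contentIdeal.map_zero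
  rcases eq_or_ne f 0 with rfl | hf
  · simp [h0]
  rcases eq_or_ne g 0 with rfl | hg
  · simp [h0]
  refine le_antisymm (contentIdeal_mul_le f g) fun x hx => ?_
  by_contra hxn
  obtain ⟨M, hM, hMx⟩ := Ideal.exists_isMaximal_of_notMem hxn
  have hMp := hM.isPrime
  obtain ⟨s, hs, a, f', hsf, hf'⟩ := exists_smul_eq_smul hD hf hM
  obtain ⟨t, ht, b, g', htg, hg'⟩ := exists_smul_eq_smul hD hg hM
  obtain ⟨n, hn⟩ := exists_coeff_mul_notMem hf' hg'
  have hfg : (s * t) • (f * g) = (a * b) • (f' * g') := by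
    rw [← smul_mul_smul_comm s f t g, hsf, htg, smul_mul_smul_comm]
  have hab : a * b * coeff n (f' * g') ∈ (f * g).contentIdeal := by
    have : a * b * coeff n (f' * g') = s * t * coeff n (f * g) := by
      simpa using (congrArg (coeff n) hfg).symm
    rw [this]
    exact Ideal.mul_mem_left _ _ (coeff_mem_contentIdeal _ n)
  have hstx : s * t * x ∈ Ideal.span {a * b} := by
    have hle : Ideal.span {s * t} * (f.contentIdeal * g.contentIdeal) ≤ Ideal.span {a * b} := by
      rw [← Ideal.span_singleton_mul_span_singleton, mul_mul_mul_comm, ← contentIdeal_smul,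
        ← contentIdeal_smul, hsf, htg, contentIdeal_smul, contentIdeal_smul, mul_mul_mul_comm,
        Ideal.span_singleton_mul_span_singleton]
      exact Ideal.mul_le_left
    exact hle (Ideal.mul_mem_mul (Ideal.mem_span_singleton_self _) hx)
  obtain ⟨z, hz⟩ := Ideal.mem_span_singleton.1 hstx
  -- Multiplying by the coefficient turns `s * t * x = a * b * z` into a multiple of an element of
  -- the content of `f * g`.
  have hmem : coeff n (f' * g') * (s * t) ∈ M := hMx _ <| by
    have : coeff n (f' * g') * (s * t) * x = z * (a * b * coeff n (f' * g')) := by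
      linear_combination coeff n (f' * g') * hz
    rw [this]
    exact Ideal.mul_mem_left _ _ hab
  rcases hMp.mem_or_mem hmem with h | h
  · exact hn h
  · exact (hMp.mem_or_mem h).elim hs ht

theorem isGaussianAmountAlgebra {D : Type*} [CommRing D] [IsNoetherianRing D]
    (hD : IsPruferDomain D) :
    IsGaussianAmountAlgebra (contentIdeal : PowerSeries D → Ideal D) powerSeriesIdeal where
  isAmountFunction := isAmountFunction_contentIdeal
  amount_formula f g := ⟨0, 0, by simp [contentIdeal_mul hD]⟩
  le_iff_mem _ _ := contentIdeal_le_iff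
  comap_eq I := by
    ext r
    refine ⟨fun h => by simpa using h 0, fun h n => ?_⟩
    rw [algebraMap_apply, Algebra.algebraMap_self_apply, coeff_C]
    split_ifs
    · exact h
    · exact I.zero_mem
  gaussian := contentIdeal_mul hD

end PowerSeries

/-- Content is computed in `D[[X]]`, so multiplicativity is inherited along the coercion. -/
theorem Polynomial.isGaussianAmountAlgebra {D : Type*} [CommRing D] [IsNoetherianRing D]
    (hD : IsPruferDomain D) :
    IsGaussianAmountAlgebra (fun f : Polynomial D => (f : PowerSeries D).contentIdeal)
      (fun I => I.map (Polynomial.C : D →+* Polynomial D)) where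
  isAmountFunction :=
    { map_zero := by simpa using PowerSeries.isAmountFunction_contentIdeal.map_zero
      map_one := by simpa using PowerSeries.isAmountFunction_contentIdeal.map_one
      eq_zero := fun f hf =>
        Polynomial.coe_eq_zero_iff.1 (PowerSeries.isAmountFunction_contentIdeal.eq_zero _ hf)
      homogeneous := fun s f => by
        rw [Polynomial.coe_smul, PowerSeries.contentIdeal_smul]
      submultiplicative := fun f g => by
        rw [Polynomial.coe_mul]
        exact PowerSeries.contentIdeal_mul_le _ _ }
  amount_formula f g := ⟨0, 0, by simp [PowerSeries.contentIdeal_mul hD]⟩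
  le_iff_mem f I := by
    simp [PowerSeries.contentIdeal_le_iff, Ideal.mem_map_C_iff]
  comap_eq I := by
    ext r
    rw [Ideal.mem_comap, Ideal.mem_map_C_iff, Polynomial.algebraMap_eq]
    refine ⟨fun h => by simpa using h 0, fun h n => ?_⟩
    rw [Polynomial.coeff_C]
    split_ifs
    · exact h
    · exact I.zero_mem
  gaussian f g := by
    rw [Polynomial.coe_mul, PowerSeries.contentIdeal_mul hD]

theorem mainTheorem5 {D : Type*} [CommRing D] :
    (IsPruferDomain D →
      ∀ (B : Type*) [CommRing B] [Algebra D B] (A : B → Ideal D) (ε : Ideal D → Ideal B),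
        IsGaussianAmountAlgebra A ε →
          ∀ I : Ideal D, absorbingNumber (ε I) = absorbingNumber I) ∧
    (IsDedekindDomain D →
      ∀ I : Ideal D,
        absorbingNumber (powerSeriesIdeal I) =
          absorbingNumber (I.map (Polynomial.C : D →+* Polynomial D)) ∧
        absorbingNumber (I.map (Polynomial.C : D →+* Polynomial D)) = absorbingNumber I) := by
  refine ⟨fun hD B _ _ A ε h I => h.absorbingNumber_eq hD I, fun hD I => ?_⟩
  have hP : IsPruferDomain D := IsDedekindDomain.isPruferDomain
  have hpoly := (Polynomial.isGaussianAmountAlgebra hP).absorbingNumber_eq hP I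
  have hps := (PowerSeries.isGaussianAmountAlgebra hP).absorbingNumber_eq hP I
  exact ⟨hps.trans hpoly.symm, hpoly⟩
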